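/- **Setting.** Let $m\ge 2$ and $\mathcal P_m=\{(i,j):1\le i<j\le m\}$. An ordering of $\mathcal P_m$ is a sequence $\mathcal O$ listing each pair of $\mathcal P_m$ exactly once; its length is $M=m(m-1)/2$. For a permutation $\mathsf q$ of $\{1,\dots,m\}$, $\mathcal O(\mathsf q)$ is obtained from $\mathcal O$ by replacing each $(i,j)$ by $(\mathsf q(i),\mathsf q(j))$, with the two entries swapped if $\mathsf q(i)>\mathsf q(j)$; we write $\mathcal O\stackrel{\mathsf p}{\sim}\mathcal O(\mathsf q)$. We write $\mathcal O\sim\mathcal O'$ if $\mathcal O'$ arises from $\mathcal O$ by finitely many transpositions of adjacent pairs with disjoint index sets, $[\mathcal X,\mathcal Y]\stackrel{\mathsf s}{\sim}[\mathcal Y,\mathcal X]$ (shift equivalence), and $\stackrel{\mathsf w}{\sim}$ for the relation generated by $\sim$ and $\stackrel{\mathsf s}{\sim}$. $\mathcal B_c^{(m)}$ consists of the orderings that list block-columns $2,3,\dots,m$ one after another, the pairs $(i,j)$, $i<j$, of column $j$ in arbitrary order; $\mathcal B_r^{(m)}$ of those that list block-rows $m-1,m-2,\dots,1$ one after another, the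 pairs $(i,j)$, $j>i$, of row $i$ in arbitrary order. $\mathcal B_{sp}^{(m)}$ consists of the orderings in $\mathcal B_c^{(m)}\cup\mathcal B_r^{(m)}$ and their reverses. $\mathcal B_{sg}^{(m)}$ is the set of $\mathcal O$ for which there are $\mathcal O'$ and $\mathcal O''\in\mathcal B_{sp}^{(m)}$ with $\mathcal O\stackrel{\mathsf p}{\sim}\mathcal O'\stackrel{\mathsf w}{\sim}\mathcal O''$ or $\mathcal O\stackrel{\mathsf w}{\sim}\mathcal O'\stackrel{\mathsf p}{\sim}\mathcal O''$. A canonical chain from $\mathcal O$ to $\mathcal O''$ with permutation $\mathsf q$ and $d$ shift equivalences consists of such an $\mathcal O'$, with $\mathcal O'=\mathcal O(\mathsf q)$ (respectively $\mathcal O''=\mathcal O'(\mathsf q)$), together with an alternating sequence of relations $\sim$ and $\stackrel{\mathsf s}{\sim}$ that links $\mathcal O'$ to $\mathcal O''$ (respectively $\mathcal O$ to $\mathcal O'$) and contains exactly $d$ shift equivalences. Let $\pi=(n_1,\dots,n_m)$, $n_r\ge1$, be a partition of $n$. Real matrices of order $n$ are partitioned into blocks $A=(A_{rs})$ by $\pi$,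 and $S(A)=\frac{\sqrt2}{2}\|A-\operatorname{diag}(A)\|_F$. For a permutation $\mathsf p$ of $\{1,\dots,m\}$ let $P$ be the permutation matrix that moves block $r$ to position $\mathsf p(r)$, and let $\pi_{\mathsf p}$ be the partition carried by $PAP^T$, i.e. its block number $\mathsf p(r)$ has order $n_r$. An orthogonal elementary block matrix with pivot pair $(i,j)$ is an orthogonal $U$ equal to the identity outside the blocks $U_{ii},U_{ij},U_{ji},U_{jj}$. For $0<\varrho\le1$ it belongs to $\mathrm{UBC}_\pi(\varrho)$ if $$\sigma_{\min}(U_{ii})=\sigma_{\min}(U_{jj})\ge\varrho\gamma_{ij},\qquad \gamma_{ij}=\frac{3}{\sqrt{(4^{n_i}+6n_j-1)(n_j+1)}}\qquad(i<j).$$ The cyclic block Jacobi method defined by $\mathcal O=(i_0,j_0),\dots,(i_{M-1},j_{M-1})$ is $A^{(k+1)}=U_k^TA^{(k)}U_k$, where $U_k$ is an orthogonal elementary block matrix with pivot pair $(i_{k\bmod M},j_{k\bmod M})$ that diagonalizes the corresponding pivot submatrix of $A^{(k)}$. One sweep is $M$ steps. **Theorem.** There are constants $\eta_{\pi,\varrho}$,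 depending only on $\pi$ and $\varrho$, and $\widetilde\eta_{n,\varrho}$, depending only on $n$ and $\varrho$, with $$0\le\eta_{\pi,\varrho}<\widetilde\eta_{n,\varrho}<1$$ for all $m\ge2$, all partitions $\pi=(n_1,\dots,n_m)$ of $n$ and all $0<\varrho\le1$, such that the following holds. Let $\mathcal O\in\mathcal B_{sg}^{(m)}$ be linked to $\mathcal O''\in\mathcal B_{sp}^{(m)}$ by a canonical chain with permutation $\mathsf q$ and $d$ shift equivalences. Let $A$ be a symmetric matrix partitioned by $\pi$ and let $A'$ be obtained from $A$ by $d+1$ sweeps of the cyclic block Jacobi method defined by $\mathcal O$. Suppose that, for some permutation $\mathsf p$ of $\{1,\dots,m\}$ (for example $\mathsf p=\mathsf q$ or $\mathsf p=\mathrm{id}$), all transformation matrices are from the class $\mathrm{UBC}_{\pi_{\mathsf p}}(\varrho)$, i.e. $PU_kP^T\in\mathrm{UBC}_{\pi_{\mathsf p}}(\varrho)$ for every step $k$ of these sweeps. Then $$S^2(A')\le\eta_{\pi_{\mathsf q},\varrho}\,S^2(A).$$ -/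

import Mathlib

namespace BlockJacobi

/-! ### Pivot orderings

Blocks are numbered by `Fin m`. A pivot sequence is a list of pivot pairs `(i, j)`, `i < j`. -/

/-- A finite sequence of pivot pairs. -/
abbrev PivotSeq (m : ℕ) := List (Fin m × Fin m)

variable {m : ℕ}

/-- The pair `(p i, p j)`, replaced by `(p j, p i)` if `p i > p j`. -/
def relabelPair (p : Equiv.Perm (Fin m)) (a : Fin m × Fin m) : Fin m × Fin m :=
  (min (p a.1) (p a.2), max (p a.1) (p a.2))

/-- The sequence `𝒪(p)`, permutation equivalent to `𝒪`. -/
def relabelSeq (p : Equiv.Perm (Fin m)) (O : PivotSeq m) : PivotSeq m :=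
  O.map (relabelPair p)

/-- `O'` is obtained from `O` by swapping two adjacent pairs whose index sets are disjoint. -/
def AdmissibleTransposition (O O' : PivotSeq m) : Prop :=
  ∃ (X Y : PivotSeq m) (a b : Fin m × Fin m),
    Disjoint ({a.1, a.2} : Set (Fin m)) {b.1, b.2} ∧
    O = X ++ a :: b :: Y ∧ O' = X ++ b :: a :: Y

/-- Equivalence `∼` : finitely many admissible transpositions. -/
def SeqEquiv : PivotSeq m → PivotSeq m → Prop :=
  Relation.ReflTransGen AdmissibleTransposition

/-- Shift equivalence: `[X, Y]` and `[Y, X]`. -/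
def ShiftEquiv (O O' : PivotSeq m) : Prop :=
  ∃ X Y : PivotSeq m, O = X ++ Y ∧ O' = Y ++ X

/-- Two sequences linked by an alternating chain `O₀ ∼ O₁ ˢ∼ O₂ ∼ O₃ ˢ∼ ⋯` of equivalences and
exactly `d` shift equivalences. As `∼` is reflexive, the chain may also begin or end
with a shift equivalence. -/
inductive WeakChain : ℕ → PivotSeq m → PivotSeq m → Prop
  | equiv {O O' : PivotSeq m} : SeqEquiv O O' → WeakChain 0 O O'
  | shift {d : ℕ} {O O₁ O₂ O' : PivotSeq m} :
      SeqEquiv O O₁ → ShiftEquiv O₁ O₂ → WeakChain d O₂ O' → WeakChain (d + 1) O O'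

/-- Weak equivalence: finitely many equivalences and shift equivalences. -/
def WeakEquiv : PivotSeq m → PivotSeq m → Prop :=
  Relation.ReflTransGen fun O O' => SeqEquiv O O' ∨ ShiftEquiv O O'

/-- Permutation equivalence. -/
def PermEquiv (O O' : PivotSeq m) : Prop :=
  ∃ q : Equiv.Perm (Fin m), O' = relabelSeq q O

/-- A chain in canonical form from `O` to `O''` with permutation `q` and `d` shift equivalences:
one permutation equivalence placed in front of or behind an alternating weak chain. -/
def CanonicalChain (q : Equiv.Perm (Fin m)) (d : ℕ) (O O'' : PivotSeq m) : Prop :=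
  (∃ O', O' = relabelSeq q O ∧ WeakChain d O' O'') ∨
  (∃ O', WeakChain d O O' ∧ O'' = relabelSeq q O')

/-- The class `B_c`: block-columns from left to right, with an arbitrary order `c j` of the
blocks above the diagonal in block-column `j`. -/
def colOrderings (m : ℕ) : Set (PivotSeq m) :=
  {O | ∃ c : Fin m → List (Fin m),
    (∀ j, (c j).Perm ((List.finRange m).filter fun i => i < j)) ∧
    O = (List.finRange m).flatMap fun j => (c j).map fun i => (i, j)}

/-- The class `B_r`: block-rows from bottom to top, with an arbitrary order `c i` of the
blocks right of the diagonal in block-row `i`. -/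
def rowOrderings (m : ℕ) : Set (PivotSeq m) :=
  {O | ∃ c : Fin m → List (Fin m),
    (∀ i, (c i).Perm ((List.finRange m).filter fun j => i < j)) ∧
    O = (List.finRange m).reverse.flatMap fun i => (c i).map fun j => (i, j)}

/-- The class `B_sp` of serial orderings with permutations. -/
def serialPermOrderings (m : ℕ) : Set (PivotSeq m) :=
  {O | O ∈ colOrderings m ∨ O.reverse ∈ colOrderings m ∨
    O ∈ rowOrderings m ∨ O.reverse ∈ rowOrderings m}

/-- The class `B_sg` of generalized serial orderings. -/
def generalizedSerialOrderings (m : ℕ) : Set (PivotSeq m) :=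
  {O | ∃ O' O'' : PivotSeq m, O'' ∈ serialPermOrderings m ∧
    ((PermEquiv O O' ∧ WeakEquiv O' O'') ∨ (WeakEquiv O O' ∧ PermEquiv O' O''))}

/-- The pivot pair at step `k` of the periodic strategy defined by `O`. -/
def pivot (O : PivotSeq m) (k : ℕ) : Option (Fin m × Fin m) := O[k % O.length]?

/-! ### Block matrices

A partition `(n_1, …, n_m)` of `n` is a function `ν : Fin m → ℕ`, `n = ∑ r, ν r`. A row or column
index is a pair: the number `r` of the block and the position inside block `r`. -/

/-- Square matrices of order `∑ r, ν r`, partitioned into blocks by `ν`. -/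
abbrev BlockMatrix (ν : Fin m → ℕ) :=
  Matrix (Σ r, Fin (ν r)) (Σ r, Fin (ν r)) ℝ

/-- The block `A_{rs}`. -/
def block {ν : Fin m → ℕ} (A : BlockMatrix ν) (r s : Fin m) :
    Matrix (Fin (ν r)) (Fin (ν s)) ℝ :=
  Matrix.of fun a b => A ⟨r, a⟩ ⟨s, b⟩

/-- The off-norm `S(A) = (√2 / 2) ‖A - diag A‖_F`. -/
noncomputable def offNorm {ν : Fin m → ℕ} (A : BlockMatrix ν) : ℝ :=
  (√2 / 2) * √(∑ x, ∑ y, ((A - Matrix.diagonal A.diag) x y) ^ 2)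

/-- The smallest singular value of a square matrix of order `k ≥ 1`
(Mathlib lists the singular values in nonincreasing order, starting with index `0`). -/
noncomputable def sigmaMin {k : ℕ} (X : Matrix (Fin k) (Fin k) ℝ) : ℝ :=
  (Matrix.toEuclideanLin X).singularValues (k - 1)

/-- `U` is an orthogonal elementary block matrix with pivot pair `a`: it agrees with the
identity outside its pivot submatrix. -/
def IsElementary {ν : Fin m → ℕ} (a : Fin m × Fin m) (U : BlockMatrix ν) : Prop :=
  U ∈ Matrix.orthogonalGroup (Σ r, Fin (ν r)) ℝ ∧
  ∀ x y : Σ r, Fin (ν r),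
    ¬ ((x.1 = a.1 ∨ x.1 = a.2) ∧ (y.1 = a.1 ∨ y.1 = a.2)) →
      U x y = (1 : BlockMatrix ν) x y

/-- `γ = 3 / √((4^{s} + 6 t - 1)(t + 1))` for pivot blocks of orders `s`, `t`. -/
noncomputable def gammaBound (s t : ℕ) : ℝ :=
  3 / √(((4 : ℝ) ^ s + 6 * t - 1) * (t + 1))

/-- The elementary matrices with pivot pair `a = (i, j)`, `i < j`, in the class `UBC_ν(ϱ)`:
`σ_min(U_ii) = σ_min(U_jj) ≥ ϱ γ_ij`. -/
def UBC (ν : Fin m → ℕ) (ϱ : ℝ) (a : Fin m × Fin m) : Set (BlockMatrix ν) :=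
  {U | IsElementary a U ∧
    sigmaMin (block U a.1 a.1) = sigmaMin (block U a.2 a.2) ∧
    ϱ * gammaBound (ν a.1) (ν a.2) ≤ sigmaMin (block U a.1 a.1)}

/-- The permuted partition: its block number `p r` has order `ν r`. -/
def permPartition (p : Equiv.Perm (Fin m)) (ν : Fin m → ℕ) : Fin m → ℕ :=
  fun r => ν (p.symm r)

/-- `P A Pᵀ`, where `P` is the permutation matrix that moves block `r` to position `p r`. -/
def relabelMatrix (p : Equiv.Perm (Fin m)) {ν : Fin m → ℕ} (A : BlockMatrix ν) :
    BlockMatrix (permPartition p ν) :=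
  Matrix.of fun x y => A ⟨p.symm x.1, x.2⟩ ⟨p.symm y.1, y.2⟩

/-- The first `N` steps `A^{(k+1)} = U_kᵀ A^{(k)} U_k` of a block Jacobi method with the
periodic strategy defined by `O`. Each `U_k` is an orthogonal elementary block
matrix for the current pivot pair, and it diagonalizes the pivot submatrix. -/
def IsBlockJacobi {ν : Fin m → ℕ} (O : PivotSeq m) (N : ℕ) (A U : ℕ → BlockMatrix ν) : Prop :=
  ∀ k < N, ∃ a, pivot O k = some a ∧
    IsElementary a (U k) ∧
    A (k + 1) = (U k).transpose * A k * U k ∧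
    ∀ x y : Σ r, Fin (ν r), (x.1 = a.1 ∨ x.1 = a.2) → (y.1 = a.1 ∨ y.1 = a.2) → x ≠ y →
      A (k + 1) x y = 0

end BlockJacobi

open BlockJacobi

/-!
The off-diagonal part `X = A - diag A` evolves linearly under a block Jacobi step: it is conjugated
by the orthogonal matrix `U` and then the pivot submatrix is replaced by zero (`offDiag_conj`). So
the method becomes a `Run` of annihilation steps, in which nothing but the pivot *sets* matters, and
the squared Frobenius norm never increases.

*Reduction to one serial sweep.* Steps with disjoint pivot sets commute (`annihStep_comm`), and
`d + 1` sweeps along `[X, Y]` contain `d` sweeps along `[Y, X]`; hence `d + 1` sweeps along an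
ordering linked to `O''` by a weak chain with `d` shifts contain, up to commuting steps, a full
sweep along `O''` (`WeakChain.contracts`). A permutation of the blocks only relabels the pivot sets.

*Strict contraction of one serial sweep.* The singular value condition bounds the determinants of
the diagonal blocks of `U` in the pivot set away from zero (`detBound_le_abs_det`), so the
admissible transformations form a compact set, and so do the runs starting on the unit sphere. The
maximum of the final norm is attained, and it is less than one unless there is a run from a
nonzero matrix that loses no norm at all, i.e. one that meets a zero pivot submatrix in every step
(`Detects.exists_contracts`). For serial orderings there is none: while a hub `j` is paired with
the preceding blocks, its blocks are multiplied by nonsingular matrices until they become pivots,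
which forces them to be zero (`LosslessRun.hub`); since lossless runs are reversible, induction over
the hubs shows that the whole matrix is zero (`LosslessRun.hubs`, `detects_of_pairwise`).
Reversibility also covers the reversed orderings.

For a given `n` there are finitely many partitions and finitely many serial lists of pivot sets, so
the contraction factor can be chosen to depend on `n` and `ϱ` only.
-/

namespace BlockJacobi

variable {m : ℕ} {ν : Fin m → ℕ} {δ : ℝ}

/-! ### Annihilation steps -/

/-- `U` agrees with the identity outside the diagonal submatrix formed by the blocks in `S`. -/
def IsIdOutside (S : Finset (Fin m)) (U : BlockMatrix ν) : Prop :=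
  ∀ x y : Σ r, Fin (ν r), ¬ (x.1 ∈ S ∧ y.1 ∈ S) → U x y = (1 : BlockMatrix ν) x y

/-- The coordinate projection onto the blocks in `S`. -/
def blockProj (ν : Fin m → ℕ) (S : Finset (Fin m)) : BlockMatrix ν :=
  Matrix.diagonal fun x => if x.1 ∈ S then 1 else 0

/-- The matrix `X` with its diagonal submatrix formed by the blocks in `S` replaced by zero. -/
def annihilate (S : Finset (Fin m)) (X : BlockMatrix ν) : BlockMatrix ν :=
  Matrix.of fun x y => if x.1 ∈ S ∧ y.1 ∈ S then 0 else X x y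

/-- The square of the Frobenius norm. -/
def sqNorm (X : BlockMatrix ν) : ℝ := ∑ x, ∑ y, X x y ^ 2

/-- Orthogonal matrices that agree with the identity outside the blocks in `S`, and whose diagonal
blocks in `S` have determinants of absolute value at least `δ`. -/
def rotations (ν : Fin m → ℕ) (δ : ℝ) (S : Finset (Fin m)) : Set (BlockMatrix ν) :=
  {U | U ∈ Matrix.orthogonalGroup (Σ r, Fin (ν r)) ℝ ∧ IsIdOutside S U ∧
    ∀ r ∈ S, δ ≤ |(block U r r).det|}

lemma annihilate_eq (S : Finset (Fin m)) (X : BlockMatrix ν) :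
    annihilate S X = X - blockProj ν S * X * blockProj ν S := by
  ext x y
  simp only [annihilate, blockProj, Matrix.of_apply, Matrix.sub_apply, Matrix.mul_diagonal,
    Matrix.diagonal_mul]
  by_cases hx : x.1 ∈ S <;> by_cases hy : y.1 ∈ S <;> simp [hx, hy]

lemma IsIdOutside.transpose {S : Finset (Fin m)} {U : BlockMatrix ν} (h : IsIdOutside S U) :
    IsIdOutside S U.transpose := by
  intro x y hxy
  rw [Matrix.transpose_apply, h y x (fun hh => hxy hh.symm)]
  simp only [Matrix.one_apply, eq_comm]

lemma IsIdOutside.eq_one_add {S : Finset (Fin m)} {U : BlockMatrix ν} (h : IsIdOutside S U) :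
    U = 1 + blockProj ν S * (U - 1) * blockProj ν S := by
  ext x y
  simp only [blockProj, Matrix.add_apply, Matrix.sub_apply, Matrix.mul_diagonal,
    Matrix.diagonal_mul]
  by_cases hxy : x.1 ∈ S ∧ y.1 ∈ S
  · simp [hxy.1, hxy.2]
  · rw [h x y hxy]
    simp

lemma blockProj_mul_blockProj {S T : Finset (Fin m)} (h : Disjoint S T) :
    blockProj ν S * blockProj ν T = 0 := by
  rw [blockProj, blockProj, Matrix.diagonal_mul_diagonal, ← Matrix.diagonal_zero]
  congr 1
  ext x
  by_cases hx : x.1 ∈ S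
  · simp [Finset.disjoint_left.1 h hx]
  · simp [hx]

lemma IsIdOutside.mul_blockProj {S T : Finset (Fin m)} {U : BlockMatrix ν} (h : IsIdOutside S U)
    (hST : Disjoint S T) : U * blockProj ν T = blockProj ν T := by
  rw [h.eq_one_add, add_mul, one_mul, mul_assoc, blockProj_mul_blockProj hST, mul_zero, add_zero]

lemma IsIdOutside.blockProj_mul {S T : Finset (Fin m)} {U : BlockMatrix ν} (h : IsIdOutside S U)
    (hST : Disjoint S T) : blockProj ν T * U = blockProj ν T := by
  rw [h.eq_one_add, mul_add, mul_one, ← mul_assoc, ← mul_assoc, blockProj_mul_blockProj hST.symm,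
    zero_mul, zero_mul, add_zero]

lemma IsIdOutside.commute {S T : Finset (Fin m)} {U V : BlockMatrix ν} (hU : IsIdOutside S U)
    (hV : IsIdOutside T V) (hST : Disjoint S T) : U * V = V * U := by
  have h1 := blockProj_mul_blockProj (ν := ν) hST
  have h2 := blockProj_mul_blockProj (ν := ν) hST.symm
  have key : ∀ B C : BlockMatrix ν, ∀ S T, blockProj ν S * blockProj ν T = 0 →
      (blockProj ν S * B * blockProj ν S) * (blockProj ν T * C * blockProj ν T) = 0 := by
    intro B C S T h
    calc _ = blockProj ν S * B * (blockProj ν S * blockProj ν T) * C * blockProj ν T := by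
          simp only [mul_assoc]
      _ = 0 := by rw [h]; simp
  rw [hU.eq_one_add, hV.eq_one_add, mul_add, add_mul, add_mul, key _ _ _ _ h1, add_mul, mul_add,
    mul_add, key _ _ _ _ h2]
  simp only [mul_one, one_mul, add_assoc, add_comm, add_left_comm]

/-- One step on the off-diagonal part: conjugation by `U` followed by annihilation of the pivot
submatrix. -/
def annihStep (S : Finset (Fin m)) (U X : BlockMatrix ν) : BlockMatrix ν :=
  annihilate S (U.transpose * X * U)

/-- Steps with disjoint pivot sets commute. -/
lemma annihStep_comm {S T : Finset (Fin m)} {U V : BlockMatrix ν} (hU : IsIdOutside S U)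
    (hV : IsIdOutside T V) (hST : Disjoint S T) (X : BlockMatrix ν) :
    annihStep T V (annihStep S U X) = annihStep S U (annihStep T V X) := by
  have key : ∀ {S T : Finset (Fin m)} {U V : BlockMatrix ν}, IsIdOutside S U →
      IsIdOutside T V → Disjoint S T → annihStep T V (annihStep S U X) =
        V.transpose * (U.transpose * X * U) * V
          - blockProj ν S * (U.transpose * X * U) * blockProj ν S
          - blockProj ν T * (V.transpose * X * V) * blockProj ν T := by
    intro S T U V hU hV hST
    have e1 := hV.mul_blockProj hST.symm
    have e2 := hV.blockProj_mul hST.symm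
    have e4 := hV.transpose.mul_blockProj hST.symm
    have e5 := hU.mul_blockProj hST
    have e6 := hU.transpose.blockProj_mul hST
    have c1 := hU.commute hV hST
    have c2 := hU.transpose.commute hV.transpose hST
    have h0 := blockProj_mul_blockProj (ν := ν) hST.symm
    have f1 : V.transpose * (blockProj ν S * (U.transpose * X * U) * blockProj ν S) * V
        = blockProj ν S * (U.transpose * X * U) * blockProj ν S := by
      calc _ = (V.transpose * blockProj ν S) * (U.transpose * X * U) * (blockProj ν S * V) := by
            simp only [mul_assoc]
        _ = _ := by rw [e4, e2]
    have f2 : blockProj ν T * (V.transpose * (U.transpose * X * U) * V) * blockProj ν T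
        = blockProj ν T * (V.transpose * X * V) * blockProj ν T := by
      calc _ = blockProj ν T * (V.transpose * U.transpose) * X * (U * V) * blockProj ν T := by
            simp only [mul_assoc]
        _ = (blockProj ν T * U.transpose) * (V.transpose * X * V) * (U * blockProj ν T) := by
            rw [c1, ← c2]; simp only [mul_assoc]
        _ = _ := by rw [e5, e6]
    have f3 : blockProj ν T * (blockProj ν S * (U.transpose * X * U) * blockProj ν S)
        * blockProj ν T = 0 := by
      simp only [← mul_assoc, h0, zero_mul]
    rw [annihStep, annihStep, annihilate_eq, annihilate_eq]
    simp only [mul_sub, sub_mul, f1, f2, f3]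
    abel
  rw [key hU hV hST, key hV hU hST.symm]
  have c1 := hU.commute hV hST
  have c2 := hU.transpose.commute hV.transpose hST
  have : V.transpose * (U.transpose * X * U) * V = U.transpose * (V.transpose * X * V) * U := by
    calc _ = (V.transpose * U.transpose) * X * (U * V) := by simp only [mul_assoc]
      _ = _ := by rw [c1, ← c2]; simp only [mul_assoc]
  rw [this]
  abel

lemma sqNorm_nonneg (X : BlockMatrix ν) : 0 ≤ sqNorm X :=
  Finset.sum_nonneg fun _ _ => Finset.sum_nonneg fun _ _ => sq_nonneg _

lemma sqNorm_smul (t : ℝ) (X : BlockMatrix ν) : sqNorm (t • X) = t ^ 2 * sqNorm X := by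
  simp [sqNorm, Finset.mul_sum, mul_pow]

lemma sqNorm_eq_trace (X : BlockMatrix ν) : sqNorm X = (X.transpose * X).trace := by
  rw [sqNorm, Finset.sum_comm]
  simp [Matrix.trace, Matrix.mul_apply, sq]

lemma sqNorm_conj {U : BlockMatrix ν} (hU : U ∈ Matrix.orthogonalGroup (Σ r, Fin (ν r)) ℝ)
    (X : BlockMatrix ν) : sqNorm (U.transpose * X * U) = sqNorm X := by
  have h : U * U.transpose = 1 := (Matrix.mem_orthogonalGroup_iff _ _).1 hU
  rw [sqNorm_eq_trace, sqNorm_eq_trace]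
  calc _ = (U.transpose * X.transpose * (U * U.transpose) * X * U).trace := by
        simp only [Matrix.transpose_mul, Matrix.transpose_transpose, mul_assoc]
    _ = (U.transpose * (X.transpose * X * U)).trace := by rw [h]; simp only [mul_assoc, one_mul]
    _ = _ := by rw [Matrix.trace_mul_comm, mul_assoc, h, mul_one]

lemma sqNorm_annihilate_le (S : Finset (Fin m)) (X : BlockMatrix ν) :
    sqNorm (annihilate S X) ≤ sqNorm X := by
  refine Finset.sum_le_sum fun x _ => Finset.sum_le_sum fun y _ => ?_
  rw [annihilate, Matrix.of_apply]
  split_ifs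
  · simpa using sq_nonneg (X x y)
  · exact le_rfl

lemma annihilate_eq_self {S : Finset (Fin m)} {X : BlockMatrix ν}
    (h : sqNorm (annihilate S X) = sqNorm X) : annihilate S X = X := by
  have hle : ∀ x y, annihilate S X x y ^ 2 ≤ X x y ^ 2 := by
    intro x y
    rw [annihilate, Matrix.of_apply]
    split_ifs
    · simpa using sq_nonneg (X x y)
    · exact le_rfl
  have h1 := (Finset.sum_eq_sum_iff_of_le fun x _ =>
    Finset.sum_le_sum fun y _ => hle x y).1 h
  ext x y
  have h2 := (Finset.sum_eq_sum_iff_of_le fun y _ => hle x y).1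
    (h1 x (Finset.mem_univ _)) y (Finset.mem_univ _)
  rw [annihilate, Matrix.of_apply] at h2 ⊢
  split_ifs at h2 ⊢
  · exact (pow_eq_zero_iff two_ne_zero).1 (by linarith) |>.symm
  · rfl

lemma isSymm_conj {X : BlockMatrix ν} (hX : X.IsSymm) (U : BlockMatrix ν) :
    (U.transpose * X * U).IsSymm := by
  rw [Matrix.IsSymm, Matrix.transpose_mul, Matrix.transpose_mul, hX.eq,
    Matrix.transpose_transpose, mul_assoc]

lemma isSymm_annihStep {X : BlockMatrix ν} (hX : X.IsSymm) (S : Finset (Fin m))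
    (U : BlockMatrix ν) : (annihStep S U X).IsSymm := by
  ext x y
  rw [Matrix.transpose_apply, annihStep, annihilate, Matrix.of_apply, Matrix.of_apply,
    (isSymm_conj hX U).apply]
  simp only [and_comm]

lemma sqNorm_annihStep_le {S : Finset (Fin m)} {δ : ℝ} {U : BlockMatrix ν}
    (hU : U ∈ rotations ν δ S) (X : BlockMatrix ν) : sqNorm (annihStep S U X) ≤ sqNorm X :=
  (sqNorm_annihilate_le _ _).trans_eq (sqNorm_conj hU.1 X)

/-! ### Runs of annihilation steps -/

/-- `Y` arises from `X` by annihilation steps with the pivot sets listed in `L`, from left to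
right, with transformations from `rotations ν δ`. -/
inductive Run (δ : ℝ) : List (Finset (Fin m)) → BlockMatrix ν → BlockMatrix ν → Prop
  | nil (X : BlockMatrix ν) : Run δ [] X X
  | cons {S : Finset (Fin m)} {L : List (Finset (Fin m))} {U X Y : BlockMatrix ν} :
      U ∈ rotations ν δ S → Run δ L (annihStep S U X) Y → Run δ (S :: L) X Y

/-- `L` contracts symmetric matrices: every run reduces the squared norm by the factor `η`. -/
def Contracts (ν : Fin m → ℕ) (δ η : ℝ) (L : List (Finset (Fin m))) : Prop :=
  ∀ X Y : BlockMatrix ν, X.IsSymm → Run δ L X Y → sqNorm Y ≤ η * sqNorm X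

lemma Run.append {L L' : List (Finset (Fin m))} {X Y Z : BlockMatrix ν} (h : Run δ L X Y)
    (h' : Run δ L' Y Z) : Run δ (L ++ L') X Z := by
  induction h with
  | nil => exact h'
  | cons hU _ ih => exact .cons hU (ih h')

lemma Run.exists_of_append {L L' : List (Finset (Fin m))} {X Z : BlockMatrix ν}
    (h : Run δ (L ++ L') X Z) : ∃ Y, Run δ L X Y ∧ Run δ L' Y Z := by
  induction L generalizing X with
  | nil => exact ⟨X, .nil X, h⟩
  | cons S L ih =>
    cases h with
    | cons hU h =>
      obtain ⟨Y, h1, h2⟩ := ih h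
      exact ⟨Y, .cons hU h1, h2⟩

lemma Run.isSymm {L : List (Finset (Fin m))} {X Y : BlockMatrix ν} (h : Run δ L X Y)
    (hX : X.IsSymm) : Y.IsSymm := by
  induction h with
  | nil => exact hX
  | cons _ _ ih => exact ih (isSymm_annihStep hX _ _)

lemma Run.sqNorm_le {L : List (Finset (Fin m))} {X Y : BlockMatrix ν} (h : Run δ L X Y) :
    sqNorm Y ≤ sqNorm X := by
  induction h with
  | nil => exact le_rfl
  | cons hU _ ih => exact ih.trans (sqNorm_annihStep_le hU _)

lemma annihStep_smul (S : Finset (Fin m)) (U X : BlockMatrix ν) (t : ℝ) :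
    annihStep S U (t • X) = t • annihStep S U X := by
  simp [annihStep, annihilate_eq, smul_sub]

lemma Run.smul {L : List (Finset (Fin m))} {X Y : BlockMatrix ν} (h : Run δ L X Y) (t : ℝ) :
    Run δ L (t • X) (t • Y) := by
  induction h with
  | nil => exact .nil _
  | cons hU _ ih => exact .cons hU (by rwa [annihStep_smul])

lemma Run.swap {S T : Finset (Fin m)} (hST : Disjoint S T) {L L' : List (Finset (Fin m))}
    {X Y : BlockMatrix ν} (h : Run δ (L ++ S :: T :: L') X Y) :
    Run δ (L ++ T :: S :: L') X Y := by
  obtain ⟨Z, h1, h2⟩ := h.exists_of_append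
  refine h1.append ?_
  cases h2 with
  | cons hU h2 =>
    cases h2 with
    | cons hV h2 =>
      rw [annihStep_comm hU.2.1 hV.2.1 hST] at h2
      exact .cons hV (.cons hU h2)

lemma Contracts.append_right {η : ℝ} {L : List (Finset (Fin m))} (h : Contracts ν δ η L)
    (L' : List (Finset (Fin m))) : Contracts ν δ η (L ++ L') := by
  intro X Y hX hR
  obtain ⟨Z, h1, h2⟩ := hR.exists_of_append
  exact h2.sqNorm_le.trans (h X Z hX h1)

lemma Contracts.append_left {η : ℝ} (hη : 0 ≤ η) {L : List (Finset (Fin m))}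
    (h : Contracts ν δ η L) (L' : List (Finset (Fin m))) : Contracts ν δ η (L' ++ L) := by
  intro X Y hX hR
  obtain ⟨Z, h1, h2⟩ := hR.exists_of_append
  exact (h Z Y (h1.isSymm hX) h2).trans (mul_le_mul_of_nonneg_left h1.sqNorm_le hη)

/-! ### Lossless runs -/

/-- The diagonal submatrix of `X` formed by the blocks in `S` is zero. -/
def VanishesOn (S : Finset (Fin m)) (X : BlockMatrix ν) : Prop :=
  ∀ x y : Σ r, Fin (ν r), x.1 ∈ S → y.1 ∈ S → X x y = 0

/-- A run along which every pivot submatrix is already zero, so that the annihilations have no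
effect and only the orthogonal conjugations remain. -/
inductive LosslessRun (δ : ℝ) : List (Finset (Fin m)) → BlockMatrix ν → BlockMatrix ν → Prop
  | nil (X : BlockMatrix ν) : LosslessRun δ [] X X
  | cons {S : Finset (Fin m)} {L : List (Finset (Fin m))} {U X Y : BlockMatrix ν} :
      U ∈ rotations ν δ S → VanishesOn S X → LosslessRun δ L (U.transpose * X * U) Y →
      LosslessRun δ (S :: L) X Y

lemma IsIdOutside.mul_apply {S : Finset (Fin m)} {U : BlockMatrix ν} (h : IsIdOutside S U)
    (Z : BlockMatrix ν) (x : Σ r, Fin (ν r)) {y : Σ r, Fin (ν r)} (hy : y.1 ∉ S) :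
    (Z * U) x y = Z x y := by
  rw [Matrix.mul_apply, Finset.sum_eq_single y]
  · rw [h y y fun hh => hy hh.1, Matrix.one_apply_eq, mul_one]
  · intro w _ hw
    rw [h w y fun hh => hy hh.2, Matrix.one_apply_ne hw, mul_zero]
  · simp

lemma IsIdOutside.transpose_mul_apply {S : Finset (Fin m)} {U : BlockMatrix ν}
    (h : IsIdOutside S U) (Z : BlockMatrix ν) {x : Σ r, Fin (ν r)} (y : Σ r, Fin (ν r))
    (hx : x.1 ∉ S) : (U.transpose * Z) x y = Z x y := by
  have := h.mul_apply Z.transpose y hx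
  rwa [← Matrix.transpose_apply (Z.transpose * U), Matrix.transpose_mul,
    Matrix.transpose_transpose] at this

lemma IsIdOutside.apply_eq_zero {S : Finset (Fin m)} {U : BlockMatrix ν} (h : IsIdOutside S U)
    {x y : Σ r, Fin (ν r)} (hx : x.1 ∉ S) (hy : y.1 ∈ S) : U x y = 0 := by
  rw [h x y fun hh => hx hh.1, Matrix.one_apply_ne]
  rintro rfl
  exact hx hy

lemma VanishesOn.conj {S : Finset (Fin m)} {U X : BlockMatrix ν} (h : IsIdOutside S U)
    (hX : VanishesOn S X) : VanishesOn S (U.transpose * X * U) := by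
  intro x y hx hy
  rw [Matrix.mul_apply]
  refine Finset.sum_eq_zero fun w _ => ?_
  by_cases hw : w.1 ∈ S
  · rw [Matrix.mul_apply, Finset.sum_eq_zero, zero_mul]
    intro z _
    by_cases hz : z.1 ∈ S
    · rw [hX z w hz hw, mul_zero]
    · rw [Matrix.transpose_apply, h.apply_eq_zero hz hx, zero_mul]
  · rw [h.apply_eq_zero hw hy, mul_zero]

lemma conj_conj_transpose {U : BlockMatrix ν}
    (hU : U ∈ Matrix.orthogonalGroup (Σ r, Fin (ν r)) ℝ) (X : BlockMatrix ν) :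
    U.transpose.transpose * (U.transpose * X * U) * U.transpose = X := by
  have h : U * U.transpose = 1 := (Matrix.mem_orthogonalGroup_iff _ _).1 hU
  calc _ = (U * U.transpose) * X * (U * U.transpose) := by
        simp only [Matrix.transpose_transpose, mul_assoc]
    _ = X := by rw [h, one_mul, mul_one]

lemma transpose_mem_rotations {S : Finset (Fin m)} {U : BlockMatrix ν}
    (hU : U ∈ rotations ν δ S) : U.transpose ∈ rotations ν δ S := by
  refine ⟨?_, hU.2.1.transpose, fun r hr => ?_⟩
  · rw [Matrix.mem_orthogonalGroup_iff, Matrix.transpose_transpose]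
    exact (Matrix.mem_orthogonalGroup_iff' _ _).1 hU.1
  · have : block U.transpose r r = (block U r r).transpose := rfl
    rw [this, Matrix.det_transpose]
    exact hU.2.2 r hr

/-- A run that preserves the norm is lossless. -/
lemma Run.lossless {L : List (Finset (Fin m))} {X Y : BlockMatrix ν} (h : Run δ L X Y)
    (hXY : sqNorm Y = sqNorm X) : LosslessRun δ L X Y := by
  induction h with
  | nil X => exact .nil X
  | @cons S L U X Y hU h ih =>
    have h1 := h.sqNorm_le
    have h2 := sqNorm_annihStep_le hU X
    have h3 : annihStep S U X = U.transpose * X * U :=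
      annihilate_eq_self (by rw [sqNorm_conj hU.1]; exact h2.antisymm (hXY ▸ h1))
    have h4 : VanishesOn S (U.transpose * X * U) := by
      intro x y hx hy
      rw [← h3, annihStep, annihilate, Matrix.of_apply, if_pos ⟨hx, hy⟩]
    refine .cons hU ?_ (h3 ▸ ih (h1.antisymm (hXY ▸ h2)))
    rw [← conj_conj_transpose hU.1 X]
    exact h4.conj hU.2.1.transpose

lemma LosslessRun.append {L L' : List (Finset (Fin m))} {X Y Z : BlockMatrix ν}
    (h : LosslessRun δ L X Y) (h' : LosslessRun δ L' Y Z) : LosslessRun δ (L ++ L') X Z := by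
  induction h with
  | nil => exact h'
  | cons hU hX _ ih => exact .cons hU hX (ih h')

lemma LosslessRun.exists_of_append {L L' : List (Finset (Fin m))} {X Z : BlockMatrix ν}
    (h : LosslessRun δ (L ++ L') X Z) :
    ∃ Y, LosslessRun δ L X Y ∧ LosslessRun δ L' Y Z := by
  induction L generalizing X with
  | nil => exact ⟨X, .nil X, h⟩
  | cons S L ih =>
    cases h with
    | cons hU hX h =>
      obtain ⟨Y, h1, h2⟩ := ih h
      exact ⟨Y, .cons hU hX h1, h2⟩

/-- Lossless runs are reversible. -/
lemma LosslessRun.reverse {L : List (Finset (Fin m))} {X Y : BlockMatrix ν}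
    (h : LosslessRun δ L X Y) : LosslessRun δ L.reverse Y X := by
  induction h with
  | nil X => exact .nil X
  | @cons S L U X Y hU hX _ ih =>
    rw [List.reverse_cons]
    refine ih.append (.cons (transpose_mem_rotations hU) (hX.conj hU.2.1) ?_)
    rw [conj_conj_transpose hU.1]
    exact .nil X

lemma LosslessRun.isSymm {L : List (Finset (Fin m))} {X Y : BlockMatrix ν}
    (h : LosslessRun δ L X Y) (hX : X.IsSymm) : Y.IsSymm := by
  induction h with
  | nil => exact hX
  | cons _ _ _ ih => exact ih (isSymm_conj hX _)

lemma LosslessRun.eq_zero {L : List (Finset (Fin m))} {X Y : BlockMatrix ν}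
    (h : LosslessRun δ L X Y) (hX : X = 0) : Y = 0 := by
  induction h with
  | nil => exact hX
  | cons _ _ _ ih => exact ih (by simp [hX])

/-- The blocks `X_{rs}` with different `r, s ∈ T` are zero. -/
def OffDiagVanishes (T : Set (Fin m)) (X : BlockMatrix ν) : Prop :=
  ∀ x y : Σ r, Fin (ν r), x.1 ∈ T → y.1 ∈ T → x.1 ≠ y.1 → X x y = 0

lemma OffDiagVanishes.conj {T : Set (Fin m)} {S : Finset (Fin m)} (hST : (S : Set (Fin m)) ⊆ T)
    {U X : BlockMatrix ν} (hU : IsIdOutside S U) (hS : VanishesOn S X) (hX : X.IsSymm)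
    (h : OffDiagVanishes T X) : OffDiagVanishes T (U.transpose * X * U) := by
  have key : ∀ x y : Σ r, Fin (ν r), x.1 ∈ T → x.1 ∉ S → y.1 ∈ S →
      (U.transpose * X * U) x y = 0 := by
    intro x y hxT hx hy
    rw [mul_assoc, hU.transpose_mul_apply _ _ hx, Matrix.mul_apply]
    refine Finset.sum_eq_zero fun w _ => ?_
    by_cases hw : w.1 ∈ S
    · rw [h x w hxT (hST hw) (fun e => hx (e ▸ hw)), zero_mul]
    · rw [hU.apply_eq_zero hw hy, mul_zero]
  intro x y hx hy hxy
  by_cases hxS : x.1 ∈ S <;> by_cases hyS : y.1 ∈ S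
  · exact hS.conj hU x y hxS hyS
  · rw [← (isSymm_conj hX U).apply]
    exact key y x hy hyS hxS
  · exact key x y hx hxS hyS
  · rw [hU.mul_apply _ _ hyS, hU.transpose_mul_apply _ _ hxS]
    exact h x y hx hy hxy

lemma LosslessRun.offDiagVanishes {T : Set (Fin m)} {L : List (Finset (Fin m))}
    {X Y : BlockMatrix ν} (h : LosslessRun δ L X Y)
    (hL : ∀ S ∈ L, (S : Set (Fin m)) ⊆ T) (hX : X.IsSymm) (hT : OffDiagVanishes T X) :
    OffDiagVanishes T Y := by
  induction h with
  | nil => exact hT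
  | cons hU hS _ ih =>
    exact ih (fun S hS => hL S (List.mem_cons_of_mem _ hS)) (isSymm_conj hX _)
      (hT.conj (hL _ List.mem_cons_self) hU.2.1 hS hX)

/-- A block `r` that occurs in some pivot set has a zero diagonal block: it is unchanged until its
first occurrence, when it lies in the pivot submatrix. -/
lemma LosslessRun.diag_eq_zero {L : List (Finset (Fin m))} {X Y : BlockMatrix ν}
    (h : LosslessRun δ L X Y) {S : Finset (Fin m)} (hSL : S ∈ L) {x y : Σ r, Fin (ν r)}
    (hx : x.1 ∈ S) (hxy : x.1 = y.1) : X x y = 0 := by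
  induction h with
  | nil => simp at hSL
  | @cons S' L U X Y hU hX _ ih =>
    by_cases hS' : x.1 ∈ S'
    · exact hX x y hS' (hxy ▸ hS')
    · have : S ∈ L := by
        rcases List.mem_cons.1 hSL with rfl | h
        · exact absurd hx hS'
        · exact h
      rw [← ih this, hU.2.1.mul_apply _ _ (hxy ▸ hS'), hU.2.1.transpose_mul_apply _ _ hS']

/-- The key step. While the hub `j` is paired with the blocks in `l` one after another, and the
blocks between members of `l` vanish, the block `X_{rj}` only gets multiplied from the right by the
nonsingular diagonal blocks `U_{jj}` until the pair `{r, j}` is reached. As it is zero by then,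
it was zero from the start. -/
lemma LosslessRun.hub (hδ : 0 < δ) {j : Fin m} {l : List (Fin m)} (hl : l.Nodup) (hj : j ∉ l)
    {X Y : BlockMatrix ν} (h : LosslessRun δ (l.map fun i => {i, j}) X Y)
    (hX : OffDiagVanishes {r | r ∈ l} X) {x y : Σ r, Fin (ν r)} (hx : x.1 ∈ l) (hy : y.1 = j) :
    X x y = 0 := by
  induction l generalizing X x y with
  | nil => simp at hx
  | cons i l ih =>
    rw [List.map_cons] at h
    cases h with
    | @cons _ _ U _ _ hU hS h =>
      rw [List.nodup_cons] at hl
      rw [List.mem_cons, not_or] at hj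
      rcases List.mem_cons.1 hx with hxi | hxl
      · exact hS x y (by simp [hxi]) (by simp [hy])
      have hnot : ∀ r ∈ l, r ∉ ({i, j} : Finset (Fin m)) := by
        intro r hr
        simp only [Finset.mem_insert, Finset.mem_singleton, not_or]
        exact ⟨fun e => hl.1 (e ▸ hr), fun e => hj.2 (e ▸ hr)⟩
      have hX' : OffDiagVanishes {r | r ∈ l} (U.transpose * X * U) := by
        intro z w hz hw hzw
        rw [hU.2.1.mul_apply _ _ (hnot _ hw), hU.2.1.transpose_mul_apply _ _ (hnot _ hz)]
        exact hX z w (List.mem_cons_of_mem _ hz) (List.mem_cons_of_mem _ hw) hzw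
      have hvec : Matrix.vecMul (fun b => X x ⟨j, b⟩) (block U j j) = 0 := by
        ext b
        have h0 : (U.transpose * X * U) x ⟨j, b⟩ = 0 := ih hl.2 hj.2 h hX' hxl rfl
        rw [mul_assoc, hU.2.1.transpose_mul_apply _ _ (hnot _ hxl), Matrix.mul_apply,
          Fintype.sum_sigma, Finset.sum_eq_single j] at h0
        · simpa [Matrix.vecMul, dotProduct, block] using h0
        · intro r _ hr
          refine Finset.sum_eq_zero fun w _ => ?_
          by_cases hri : r = i
          · subst hri
            rw [hX x ⟨r, w⟩ hx (by simp) (fun e => hl.1 (by simpa [e] using hxl)), zero_mul]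
          · rw [hU.2.1.apply_eq_zero (by simp [hr, hri]) (by simp), mul_zero]
        · simp
      have hdet : (block U j j).det ≠ 0 := by
        have := hδ.trans_le (hU.2.2 j (by simp))
        exact abs_pos.1 this
      have := congrFun (Matrix.eq_zero_of_vecMul_eq_zero hdet hvec)
      obtain ⟨r, b⟩ := y
      subst hy
      exact this b

/-- Hubs taken one after another, each paired with all preceding ones in some order. -/
lemma LosslessRun.hubs (hδ : 0 < δ) {f : Fin m → Fin m} (hf : f.Injective)
    {c : Fin m → List (Fin m)} {js : List (Fin m)}
    (hc : ∀ pre j, pre ++ [j] <+: js → (c j).Nodup ∧ j ∉ c j ∧ ∀ i, i ∈ c j ↔ i ∈ pre)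
    {X Y : BlockMatrix ν} (hX : X.IsSymm)
    (h : LosslessRun δ (js.flatMap fun j => (c j).map fun i => {f i, f j}) X Y) :
    OffDiagVanishes {r | r ∈ js.map f} X := by
  induction js using List.reverseRecOn generalizing Y with
  | nil =>
    intro x y hx
    simp at hx
  | append_singleton pre j ih =>
    rw [List.flatMap_append, List.flatMap_singleton] at h
    obtain ⟨Z, h1, h2⟩ := h.exists_of_append
    obtain ⟨hnd, hjc, hmem⟩ := hc pre j (List.prefix_refl _)
    have hpre : ∀ r, r ∈ (c j).map f ↔ r ∈ pre.map f := by simp [hmem]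
    have hsub : ∀ S ∈ pre.flatMap fun j => (c j).map fun i => ({f i, f j} : Finset (Fin m)),
        (S : Set (Fin m)) ⊆ {r | r ∈ pre.map f} := by
      intro S hS
      simp only [List.mem_flatMap, List.mem_map] at hS
      obtain ⟨k, hk, i, hi, rfl⟩ := hS
      obtain ⟨s, t, rfl⟩ := List.append_of_mem hk
      have hi' := ((hc s k ⟨t ++ [j], by simp⟩).2.2 i).1 hi
      intro r hr
      rw [Finset.coe_insert, Finset.coe_singleton] at hr
      rcases hr with rfl | rfl
      · exact List.mem_map_of_mem (List.mem_append_left _ hi')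
      · exact List.mem_map_of_mem hk
    have hXpre := ih (fun s k hs => hc s k (hs.trans (List.prefix_append _ _))) h1
    have hZpre := h1.offDiagVanishes hsub hX hXpre
    have hZs := h1.isSymm hX
    -- The new hub's blocks vanish before its stage, hence, by reversibility, from the start.
    have hhub : ∀ x y : Σ r, Fin (ν r), x.1 ∈ pre.map f → y.1 = f j → Z x y = 0 := by
      intro x y hx hy
      have h2' : LosslessRun δ (((c j).map f).map fun i => {i, f j}) Z Y := by
        rw [List.map_map]
        exact h2
      refine h2'.hub hδ (hnd.map hf) ?_ ?_ ((hpre _).2 hx) hy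
      · rwa [List.mem_map_of_injective hf]
      · intro z w hz hw
        exact hZpre z w ((hpre _).1 hz) ((hpre _).1 hw)
    have hZ : OffDiagVanishes {r | r ∈ (pre ++ [j]).map f} Z := by
      intro x y hx hy hxy
      simp only [List.map_append, List.map_cons, List.map_nil, List.mem_append,
        List.mem_singleton, Set.mem_ofPred_eq] at hx hy
      rcases hx with hx | hx <;> rcases hy with hy | hy
      · exact hZpre x y hx hy hxy
      · exact hhub x y hx hy
      · rw [← hZs.apply]
        exact hhub y x hy hx
      · exact absurd (hx.trans hy.symm) hxy
    refine h1.reverse.offDiagVanishes (fun S hS => ?_) hZs hZ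
    refine (hsub S (List.mem_reverse.1 hS)).trans fun r hr => ?_
    simp only [Set.mem_ofPred_eq, List.map_append, List.mem_append] at hr ⊢
    exact Or.inl hr

/-- `L` detects symmetric matrices: only the zero matrix admits a lossless run along `L`. -/
def Detects (ν : Fin m → ℕ) (δ : ℝ) (L : List (Finset (Fin m))) : Prop :=
  ∀ X Y : BlockMatrix ν, X.IsSymm → LosslessRun δ L X Y → X = 0

lemma Detects.reverse {L : List (Finset (Fin m))} (h : Detects ν δ L) :
    Detects ν δ L.reverse := by
  intro X Y hX hR
  have hR' := hR.reverse
  rw [List.reverse_reverse] at hR'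
  exact hR'.eq_zero (h Y X (hR.isSymm hX) hR')

/-- Stages in the order of a strict order `R`, with hub `j` paired with its `R`-predecessors. -/
lemma detects_of_pairwise (hδ : 0 < δ) (hm : 2 ≤ m) (q : Equiv.Perm (Fin m))
    {R : Fin m → Fin m → Prop} [DecidableRel R] (hR : ∀ i j, R i j → ¬ R j i)
    {js : List (Fin m)} (hjs : js.Pairwise R) (hall : ∀ r, r ∈ js) {c : Fin m → List (Fin m)}
    (hc : ∀ j, (c j).Perm ((List.finRange m).filter fun i => R i j)) :
    Detects ν δ (js.flatMap fun j => (c j).map fun i => {q i, q j}) := by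
  have hmem : ∀ i j, i ∈ c j ↔ R i j := by
    intro i j
    rw [(hc j).mem_iff]
    simp
  intro X Y hX h
  have hoff := h.hubs hδ q.injective (fun pre j hpre => ?_) hX
  · ext x y
    by_cases hxy : x.1 = y.1
    · -- As `m ≥ 2`, block `x.1` occurs in some pivot set.
      obtain ⟨S, hS, hxS⟩ : ∃ S ∈ js.flatMap fun j => (c j).map fun i => ({q i, q j} :
          Finset (Fin m)), x.1 ∈ S := by
        have : Nontrivial (Fin m) := Fin.nontrivial_iff_two_le.2 hm
        obtain ⟨s, hs⟩ := exists_ne (q.symm x.1)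
        have hRR : R s (q.symm x.1) ∨ R (q.symm x.1) s := by
          have : Std.Symm fun i j => R i j ∨ R j i := ⟨fun _ _ => Or.symm⟩
          have hp : js.Pairwise fun i j => R i j ∨ R j i := hjs.imp Or.inl
          exact hp.forall (hall _) (hall _) hs
        rcases hRR with hr | hr
        · refine ⟨{q s, q (q.symm x.1)}, ?_, by simp⟩
          exact List.mem_flatMap.2 ⟨_, hall _, List.mem_map.2 ⟨s, (hmem _ _).2 hr, rfl⟩⟩
        · refine ⟨{q (q.symm x.1), q s}, ?_, by simp⟩
          exact List.mem_flatMap.2 ⟨_, hall _, List.mem_map.2 ⟨_, (hmem _ _).2 hr, rfl⟩⟩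
      exact h.diag_eq_zero hS hxS hxy
    · refine hoff x y ?_ ?_ hxy
      · exact List.mem_map.2 ⟨q.symm x.1, hall _, by simp⟩
      · exact List.mem_map.2 ⟨q.symm y.1, hall _, by simp⟩
  · refine ⟨(hc j).nodup_iff.2 ((List.nodup_finRange m).filter _), fun hj => ?_, fun i => ?_⟩
    · exact hR j j ((hmem _ _).1 hj) ((hmem _ _).1 hj)
    · rw [hmem]
      obtain ⟨post, rfl⟩ := hpre
      have hp := List.pairwise_append.1 hjs
      have hp1 := List.pairwise_append.1 hp.1
      refine ⟨fun hij => ?_, fun hi => hp1.2.2 i hi j (by simp)⟩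
      have := hall i
      simp only [List.mem_append, List.mem_singleton] at this
      rcases this with (hi | rfl) | hi
      · exact hi
      · exact absurd hij (hR _ _ hij)
      · exact absurd hij (hR _ _ (hp.2.2 j (by simp) i hi))

/-! ### Compactness -/

lemma isCompact_entries_le_one :
    IsCompact {X : BlockMatrix ν | ∀ x y, X x y ∈ Set.Icc (-1 : ℝ) 1} := by
  have h : IsCompact (Set.univ.pi fun _ => Set.univ.pi fun _ => Set.Icc (-1 : ℝ) 1 :
      Set ((Σ r, Fin (ν r)) → (Σ r, Fin (ν r)) → ℝ)) :=
    isCompact_univ_pi fun _ => isCompact_univ_pi fun _ => isCompact_Icc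
  change IsCompact (X := (Σ r, Fin (ν r)) → (Σ r, Fin (ν r)) → ℝ)
    {X | ∀ x y, X x y ∈ Set.Icc (-1 : ℝ) 1}
  convert h using 1
  ext X
  simp only [Set.mem_ofPred_eq, Set.mem_pi, Set.mem_univ, true_implies]

lemma continuous_sqNorm : Continuous (sqNorm : BlockMatrix ν → ℝ) :=
  continuous_finsetSum _ fun x _ => continuous_finsetSum _ fun y _ =>
    (continuous_id.matrix_elem x y).pow 2

lemma isCompact_rotations (δ : ℝ) (S : Finset (Fin m)) : IsCompact (rotations ν δ S) := by
  refine isCompact_entries_le_one.of_isClosed_subset ?_ ?_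
  · have h1 : IsClosed {U : BlockMatrix ν | U * U.transpose = 1} :=
      isClosed_eq (continuous_id.matrix_mul continuous_id.matrix_transpose) continuous_const
    have h2 : IsClosed {U : BlockMatrix ν | IsIdOutside S U} := by
      simp only [IsIdOutside, Set.ofPred_forall]
      exact isClosed_iInter fun x => isClosed_iInter fun y => isClosed_iInter fun _ =>
        isClosed_eq (continuous_id.matrix_elem x y) continuous_const
    have h3 : IsClosed {U : BlockMatrix ν | ∀ r ∈ S, δ ≤ |(block U r r).det|} := by
      simp only [Set.ofPred_forall]
      refine isClosed_iInter fun r => isClosed_iInter fun _ => isClosed_le continuous_const ?_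
      have hb : Continuous fun U : BlockMatrix ν => block U r r :=
        continuous_matrix fun a b =>
          (continuous_id (X := BlockMatrix ν)).matrix_elem ⟨r, a⟩ ⟨r, b⟩
      exact hb.matrix_det.abs
    convert h1.inter (h2.inter h3) using 1
    ext U
    exact and_congr_left' (Matrix.mem_orthogonalGroup_iff _ _)
  · intro U hU x y
    have := entry_norm_bound_of_unitary hU.1 x y
    exact abs_le.1 this

/-- The runs along `L` whose starting points range over a compact set form a compact set. A first
component is carried along so as to remember the starting point. -/
lemma isCompact_run (L : List (Finset (Fin m))) {K : Set (BlockMatrix ν × BlockMatrix ν)}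
    (hK : IsCompact K) :
    IsCompact {p : BlockMatrix ν × BlockMatrix ν | ∃ X, (p.1, X) ∈ K ∧ Run δ L X p.2} := by
  induction L generalizing K with
  | nil =>
    convert hK using 1
    ext p
    constructor
    · rintro ⟨X, hX, h⟩
      cases h
      exact hX
    · exact fun hp => ⟨p.2, hp, .nil _⟩
  | cons S L ih =>
    have hc : Continuous fun p : (BlockMatrix ν × BlockMatrix ν) × BlockMatrix ν =>
        (p.1.1, annihStep S p.2 p.1.2) := by
      simp only [annihStep, annihilate_eq]
      fun_prop
    convert ih ((hK.prod (isCompact_rotations δ S)).image hc) using 1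
    ext p
    constructor
    · rintro ⟨X, hX, h⟩
      cases h with
      | @cons _ _ U _ _ hU h => exact ⟨_, ⟨((p.1, X), U), ⟨hX, hU⟩, rfl⟩, h⟩
    · rintro ⟨Z, ⟨⟨⟨X₀, X⟩, U⟩, ⟨hX, hU⟩, he⟩, h⟩
      obtain ⟨rfl, rfl⟩ := Prod.mk.injEq .. ▸ he
      exact ⟨X, hX, .cons hU h⟩

lemma isCompact_unitSphere : IsCompact {X : BlockMatrix ν | X.IsSymm ∧ sqNorm X = 1} := by
  refine isCompact_entries_le_one.of_isClosed_subset ?_ ?_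
  · exact (isClosed_eq continuous_id.matrix_transpose continuous_id).inter
      (isClosed_eq continuous_sqNorm continuous_const)
  · rintro X ⟨-, hX⟩ x y
    have h1 : X x y ^ 2 ≤ sqNorm X :=
      (Finset.single_le_sum (f := fun y => X x y ^ 2) (fun _ _ => sq_nonneg _)
        (Finset.mem_univ y)).trans
      (Finset.single_le_sum (f := fun x => ∑ y, X x y ^ 2)
        (fun _ _ => Finset.sum_nonneg fun _ _ => sq_nonneg _) (Finset.mem_univ x))
    rw [hX] at h1
    exact abs_le.1 ((sq_le_one_iff_abs_le_one _).1 h1)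

/-- By compactness, a list that admits no nonzero lossless run contracts by a factor less
than one. -/
lemma Detects.exists_contracts {L : List (Finset (Fin m))} (h : Detects ν δ L) :
    ∃ η, 0 ≤ η ∧ η < 1 ∧ Contracts ν δ η L := by
  let G : Set (BlockMatrix ν × BlockMatrix ν) :=
    {p | ∃ X, (p.1, X) ∈ (fun X => (X, X)) '' {X : BlockMatrix ν | X.IsSymm ∧ sqNorm X = 1} ∧
      Run δ L X p.2}
  have hG : IsCompact G :=
    isCompact_run L (isCompact_unitSphere.image (continuous_id.prodMk continuous_id))
  have hmem : ∀ {X Y : BlockMatrix ν}, X.IsSymm → sqNorm X = 1 → Run δ L X Y → (X, Y) ∈ G :=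
    fun {X Y} hX h1 hR => ⟨X, ⟨X, ⟨hX, h1⟩, rfl⟩, hR⟩
  have hmem' : ∀ p ∈ G, p.1.IsSymm ∧ sqNorm p.1 = 1 ∧ Run δ L p.1 p.2 := by
    rintro ⟨X, Y⟩ ⟨Z, ⟨W, ⟨hW, h1⟩, he⟩, hR⟩
    obtain ⟨rfl, rfl⟩ := Prod.mk.injEq .. ▸ he
    exact ⟨hW, h1, hR⟩
  obtain ⟨η, h0, h1, hη⟩ : ∃ η : ℝ, 0 ≤ η ∧ η < 1 ∧ ∀ p ∈ G, sqNorm p.2 ≤ η := by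
    rcases G.eq_empty_or_nonempty with hE | hN
    · exact ⟨0, le_rfl, one_pos, by simp [hE]⟩
    obtain ⟨p, hp, hmax⟩ := hG.exists_isMaxOn hN
      (continuous_sqNorm.comp continuous_snd).continuousOn
    obtain ⟨hs, hp1, hR⟩ := hmem' p hp
    refine ⟨sqNorm p.2, sqNorm_nonneg _, lt_of_le_of_ne (hR.sqNorm_le.trans_eq hp1) ?_,
      fun r hr => hmax hr⟩
    intro he
    have h0 := h _ _ hs (hR.lossless (he.trans hp1.symm))
    rw [h0] at hp1
    simp [sqNorm] at hp1
  refine ⟨η, h0, h1, fun X Y hX hR => ?_⟩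
  rcases (sqNorm_nonneg X).eq_or_lt with hz | hpos
  · rw [← hz, mul_zero, hz]
    exact hR.sqNorm_le
  · set t := (√(sqNorm X))⁻¹ with ht
    have ht2 : t ^ 2 * sqNorm X = 1 := by
      rw [ht, inv_pow, Real.sq_sqrt hpos.le, inv_mul_cancel₀ hpos.ne']
    have hle := hη _ (hmem (hX.smul t) ((sqNorm_smul t X).trans ht2) (hR.smul t))
    rw [sqNorm_smul] at hle
    calc sqNorm Y = (t ^ 2 * sqNorm X) * sqNorm Y := by rw [ht2, one_mul]
      _ = (t ^ 2 * sqNorm Y) * sqNorm X := by ring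
      _ ≤ η * sqNorm X := mul_le_mul_of_nonneg_right hle hpos.le

/-- One factor serves all detecting lists of bounded length, since there are finitely many. -/
lemma exists_contracts_of_length_le (ν : Fin m → ℕ) (δ : ℝ) (N : ℕ) :
    ∃ η, 0 ≤ η ∧ η < 1 ∧ ∀ L : List (Finset (Fin m)), L.length ≤ N → Detects ν δ L →
      Contracts ν δ η L := by
  have hex : ∀ L : List (Finset (Fin m)), ∃ η : ℝ, 0 ≤ η ∧ η < 1 ∧
      (Detects ν δ L → Contracts ν δ η L) := by
    intro L
    by_cases h : Detects ν δ L
    · obtain ⟨η, h0, h1, hη⟩ := h.exists_contracts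
      exact ⟨η, h0, h1, fun _ => hη⟩
    · exact ⟨0, le_rfl, one_pos, fun h' => absurd h' h⟩
  choose η h0 h1 hη using hex
  obtain ⟨L₀, -, hmax⟩ := Set.exists_max_image {L : List (Finset (Fin m)) | L.length ≤ N} η
    (List.finite_length_le _ _) ⟨[], by simp⟩
  exact ⟨η L₀, h0 _, h1 _, fun L hL hD X Y hX hR => (hη L hD X Y hX hR).trans
    (mul_le_mul_of_nonneg_right (hmax L hL) (sqNorm_nonneg X))⟩

/-- One factor serves all partitions of `n` at once. -/
lemma exists_contracts_of_sum_eq (n : ℕ) (δ : ℝ) :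
    ∃ η, 0 ≤ η ∧ η < 1 ∧ ∀ (m : ℕ) (ν : Fin m → ℕ), (∀ r, 1 ≤ ν r) → ∑ r, ν r = n →
      ∀ L : List (Finset (Fin m)), L.length ≤ m * m → Detects ν δ L → Contracts ν δ η L := by
  choose η h0 h1 hη using fun (m : ℕ) (ν : Fin m → ℕ) =>
    exists_contracts_of_length_le ν δ (m * m)
  obtain ⟨⟨m₀, ν₀⟩, -, hmax⟩ := Set.exists_max_image
    ((fun p : Σ m : Fin (n + 1), (Fin m → Fin (n + 1)) =>
      (⟨p.1, fun r => p.2 r⟩ : Σ m : ℕ, (Fin m → ℕ))) '' Set.univ)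
    (fun p => η p.1 p.2) (Set.finite_univ.image _) ⟨_, ⟨⟨0, fun _ => 0⟩, trivial, rfl⟩⟩
  refine ⟨η m₀ ν₀, h0 _ _, h1 _ _, fun m ν hν hsum L hL hD X Y hX hR =>
    (hη m ν L hL hD X Y hX hR).trans (mul_le_mul_of_nonneg_right ?_ (sqNorm_nonneg X))⟩
  have hm : m ≤ n := by
    calc m = ∑ _r : Fin m, 1 := by simp
      _ ≤ ∑ r, ν r := Finset.sum_le_sum fun r _ => hν r
      _ = n := hsum
  have hr : ∀ r, ν r ≤ n := fun r =>
    (Finset.single_le_sum (f := ν) (fun _ _ => Nat.zero_le _) (Finset.mem_univ r)).trans_eq hsum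
  exact hmax ⟨m, ν⟩ ⟨⟨⟨m, Nat.lt_succ_of_le hm⟩, fun r => ⟨ν r, Nat.lt_succ_of_le (hr r)⟩⟩,
    trivial, rfl⟩

/-! ### Pivot orderings -/

/-- The pivot set of a pivot pair. -/
def pivotSet (a : Fin m × Fin m) : Finset (Fin m) := {a.1, a.2}

lemma mem_pivotSet {a : Fin m × Fin m} {r : Fin m} : r ∈ pivotSet a ↔ r = a.1 ∨ r = a.2 := by
  simp [pivotSet]

lemma pivotSet_relabelPair (q : Equiv.Perm (Fin m)) (a : Fin m × Fin m) :
    pivotSet (relabelPair q a) = (pivotSet a).image q := by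
  rw [pivotSet, pivotSet, relabelPair, Finset.image_insert, Finset.image_singleton]
  rcases le_total (q a.1) (q a.2) with h | h
  · rw [min_eq_left h, max_eq_right h]
  · rw [min_eq_right h, max_eq_left h, Finset.pair_comm]

lemma map_relabelSeq (q : Equiv.Perm (Fin m)) (O : PivotSeq m) :
    (relabelSeq q O).map (fun a => (pivotSet a).image q.symm) = O.map pivotSet := by
  rw [relabelSeq, List.map_map]
  refine List.map_congr_left fun a _ => ?_
  rw [Function.comp_apply, pivotSet_relabelPair, Finset.image_image]
  simp

lemma disjoint_image_pivotSet (q : Equiv.Perm (Fin m)) {a b : Fin m × Fin m}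
    (h : Disjoint ({a.1, a.2} : Set (Fin m)) {b.1, b.2}) :
    Disjoint ((pivotSet a).image q) ((pivotSet b).image q) := by
  rw [Finset.disjoint_image q.injective, ← Finset.disjoint_coe]
  simpa [pivotSet] using h

lemma detects_of_mem_colOrderings (hδ : 0 < δ) (hm : 2 ≤ m) (q : Equiv.Perm (Fin m))
    {O : PivotSeq m} (hO : O ∈ colOrderings m) :
    Detects ν δ (O.map fun a => (pivotSet a).image q) := by
  obtain ⟨c, hc, rfl⟩ := hO
  convert detects_of_pairwise (R := fun i j => i < j) hδ hm q (fun i j => lt_asymm)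
    (List.pairwise_lt_finRange m) List.mem_finRange hc using 1
  simp [List.map_flatMap, pivotSet, Function.comp_def, Finset.image_insert]

lemma detects_of_mem_rowOrderings (hδ : 0 < δ) (hm : 2 ≤ m) (q : Equiv.Perm (Fin m))
    {O : PivotSeq m} (hO : O ∈ rowOrderings m) :
    Detects ν δ (O.map fun a => (pivotSet a).image q) := by
  obtain ⟨c, hc, rfl⟩ := hO
  convert detects_of_pairwise (R := fun i j => j < i) hδ hm q (fun i j => lt_asymm)
    (List.pairwise_reverse.2 (List.pairwise_lt_finRange m))
    (fun r => List.mem_reverse.2 (List.mem_finRange r)) hc using 1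
  simp [List.map_flatMap, pivotSet, Function.comp_def, Finset.image_insert, Finset.pair_comm]

lemma detects_of_mem_serialPermOrderings (hδ : 0 < δ) (hm : 2 ≤ m) (q : Equiv.Perm (Fin m))
    {O : PivotSeq m} (hO : O ∈ serialPermOrderings m) :
    Detects ν δ (O.map fun a => (pivotSet a).image q) := by
  have hrev : Detects ν δ (O.reverse.map fun a => (pivotSet a).image q) →
      Detects ν δ (O.map fun a => (pivotSet a).image q) := by
    intro h
    have := h.reverse
    rwa [← List.map_reverse, List.reverse_reverse] at this
  rcases hO with h | h | h | h
  · exact detects_of_mem_colOrderings hδ hm q h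
  · exact hrev (detects_of_mem_colOrderings hδ hm q h)
  · exact detects_of_mem_rowOrderings hδ hm q h
  · exact hrev (detects_of_mem_rowOrderings hδ hm q h)

lemma length_le_of_mem_serialPermOrderings {O : PivotSeq m} (hO : O ∈ serialPermOrderings m) :
    O.length ≤ m * m := by
  have key : ∀ (js : List (Fin m)) (c : Fin m → List (Fin m)) (f : Fin m → Fin m → Fin m × Fin m)
      (p : Fin m → Fin m → Bool), js.length = m →
      (∀ j, (c j).Perm ((List.finRange m).filter (p j))) →
      (js.flatMap fun j => (c j).map (f j)).length ≤ m * m := by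
    intro js c f p hjs hc
    rw [List.length_flatMap]
    have hle := List.sum_le_card_nsmul (js.map fun j => ((c j).map (f j)).length) m (by
      intro k hk
      obtain ⟨j, -, rfl⟩ := List.mem_map.1 hk
      rw [List.length_map, (hc j).length_eq]
      exact (List.length_filter_le _ _).trans_eq List.length_finRange)
    rwa [List.length_map, hjs, smul_eq_mul] at hle
  have hcol : ∀ {O : PivotSeq m}, O ∈ colOrderings m → O.length ≤ m * m := by
    rintro O ⟨c, hc, rfl⟩
    exact key _ c (fun j i => (i, j)) (fun j i => decide (i < j)) List.length_finRange hc
  have hrow : ∀ {O : PivotSeq m}, O ∈ rowOrderings m → O.length ≤ m * m := by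
    rintro O ⟨c, hc, rfl⟩
    exact key _ c (fun i j => (i, j)) (fun i j => decide (i < j)) (by simp) hc
  rcases hO with h | h | h | h
  · exact hcol h
  · simpa using hcol h
  · exact hrow h
  · simpa using hrow h

/-- Equivalent pivot sequences have the same runs. -/
lemma Run.of_seqEquiv {G : Fin m × Fin m → Finset (Fin m)}
    (hG : ∀ a b : Fin m × Fin m, Disjoint ({a.1, a.2} : Set (Fin m)) {b.1, b.2} →
      Disjoint (G a) (G b)) {O O' : PivotSeq m} (h : SeqEquiv O O') {X Y : BlockMatrix ν}
    (hR : Run δ (O.map G) X Y) : Run δ (O'.map G) X Y := by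
  induction h with
  | refl => exact hR
  | tail _ h ih =>
    obtain ⟨P, Q, a, b, hab, rfl, rfl⟩ := h
    rw [List.map_append, List.map_cons, List.map_cons] at ih ⊢
    exact ih.swap (hG a b hab)

lemma Run.replicate_congr {L L' : List (Finset (Fin m))}
    (h : ∀ {X Y : BlockMatrix ν}, Run δ L X Y → Run δ L' X Y) (n : ℕ) {X Y : BlockMatrix ν}
    (hR : Run δ (List.replicate n L).flatten X Y) :
    Run δ (List.replicate n L').flatten X Y := by
  induction n generalizing X with
  | zero => exact hR
  | succ n ih =>
    rw [List.replicate_succ, List.flatten_cons] at hR ⊢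
    obtain ⟨Z, h1, h2⟩ := hR.exists_of_append
    exact (h h1).append (ih h2)

lemma flatten_replicate_append {α : Type*} (x y : List α) (n : ℕ) :
    (List.replicate (n + 1) (x ++ y)).flatten = x ++ (List.replicate n (y ++ x)).flatten ++ y := by
  induction n with
  | zero => simp
  | succ n ih =>
    rw [List.replicate_succ, List.flatten_cons, ih, List.replicate_succ, List.flatten_cons]
    simp only [List.append_assoc]

/-- A weak chain with `d` shifts costs at most `d` additional sweeps: `n + 1` sweeps along `[X, Y]`
contain `n` sweeps along `[Y, X]`. -/
lemma WeakChain.contracts {η : ℝ} (hη : 0 ≤ η) {G : Fin m × Fin m → Finset (Fin m)}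
    (hG : ∀ a b : Fin m × Fin m, Disjoint ({a.1, a.2} : Set (Fin m)) {b.1, b.2} →
      Disjoint (G a) (G b)) {d : ℕ} {O O' : PivotSeq m} (h : WeakChain d O O')
    (hO' : Contracts ν δ η (O'.map G)) :
    Contracts ν δ η (List.replicate (d + 1) (O.map G)).flatten := by
  induction h with
  | equiv h =>
    intro X Y hX hR
    refine hO' X Y hX (Run.of_seqEquiv hG h ?_)
    simpa using hR
  | @shift d O O₁ O₂ O' h hs _ ih =>
    obtain ⟨P, Q, rfl, rfl⟩ := hs
    intro X Y hX hR
    replace hR := hR.replicate_congr (Run.of_seqEquiv hG h)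
    rw [List.map_append, flatten_replicate_append] at hR
    have := ih hO'
    rw [List.map_append] at this
    exact ((this.append_left hη _).append_right _) X Y hX hR

/-- A list linked to a serial ordering by a canonical chain contracts in `d + 1` sweeps. -/
lemma CanonicalChain.contracts {η : ℝ} (hη : 0 ≤ η) (hδ : 0 < δ) (hm : 2 ≤ m)
    (hL : ∀ L : List (Finset (Fin m)), L.length ≤ m * m → Detects ν δ L → Contracts ν δ η L)
    {q : Equiv.Perm (Fin m)} {d : ℕ} {O O'' : PivotSeq m} (h : CanonicalChain q d O O'')
    (hO'' : O'' ∈ serialPermOrderings m) :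
    Contracts ν δ η (List.replicate (d + 1) (O.map pivotSet)).flatten := by
  have hc : Contracts ν δ η (O''.map fun a => (pivotSet a).image q.symm) :=
    hL _ (by simpa using length_le_of_mem_serialPermOrderings hO'')
      (detects_of_mem_serialPermOrderings hδ hm q.symm hO'')
  rcases h with ⟨O', rfl, hw⟩ | ⟨O', hw, rfl⟩
  · rw [← map_relabelSeq q O]
    exact hw.contracts hη (fun a b hab => disjoint_image_pivotSet q.symm hab) hc
  · rw [map_relabelSeq] at hc
    refine hw.contracts hη (fun a b hab => ?_) hc
    simpa using disjoint_image_pivotSet 1 hab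

/-! ### From the block Jacobi method to annihilation runs -/

/-- The matrix `A` with its diagonal entries replaced by zero. -/
def offDiag (A : BlockMatrix ν) : BlockMatrix ν := A - Matrix.diagonal A.diag

lemma offNorm_sq (A : BlockMatrix ν) : offNorm A ^ 2 = 1 / 2 * sqNorm (offDiag A) := by
  have h : offNorm A = √2 / 2 * √(sqNorm (offDiag A)) := rfl
  rw [h, mul_pow, div_pow, Real.sq_sqrt (by norm_num), Real.sq_sqrt (sqNorm_nonneg _)]
  norm_num

lemma isSymm_offDiag {A : BlockMatrix ν} (hA : A.IsSymm) : (offDiag A).IsSymm := by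
  rw [Matrix.IsSymm, offDiag, Matrix.transpose_sub, hA.eq, Matrix.diagonal_transpose]

lemma IsIdOutside.conj_diagonal_apply {S : Finset (Fin m)} {U : BlockMatrix ν}
    (h : IsIdOutside S U) (v : (Σ r, Fin (ν r)) → ℝ) {x y : Σ r, Fin (ν r)}
    (hxy : ¬ (x.1 ∈ S ∧ y.1 ∈ S)) :
    (U.transpose * Matrix.diagonal v * U) x y = Matrix.diagonal v x y := by
  by_cases hy : y.1 ∈ S
  · have hx : x.1 ∉ S := fun hx => hxy ⟨hx, hy⟩
    rw [mul_assoc, h.transpose_mul_apply _ _ hx, Matrix.diagonal_mul, h x y hxy,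
      Matrix.one_apply, Matrix.diagonal_apply, mul_ite, mul_one, mul_zero]
  · rw [h.mul_apply _ _ hy, Matrix.mul_diagonal, h.transpose x y hxy, Matrix.one_apply,
      Matrix.diagonal_apply, ite_mul, one_mul, zero_mul]
    split_ifs with e
    · rw [e]
    · rfl

/-- A step that diagonalizes the pivot submatrix acts on the off-diagonal part as an annihilation
step: outside the pivot submatrix the diagonal of `A` contributes nothing. -/
lemma offDiag_conj {S : Finset (Fin m)} {U A : BlockMatrix ν} (hU : IsIdOutside S U)
    (h0 : ∀ x y : Σ r, Fin (ν r), x.1 ∈ S → y.1 ∈ S → x ≠ y →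
      (U.transpose * A * U) x y = 0) :
    offDiag (U.transpose * A * U) = annihStep S U (offDiag A) := by
  ext x y
  rw [annihStep, annihilate, Matrix.of_apply, offDiag, Matrix.sub_apply]
  split_ifs with hxy
  · by_cases e : x = y
    · subst e
      simp
    · rw [h0 x y hxy.1 hxy.2 e, Matrix.diagonal_apply_ne _ e, sub_zero]
  · rw [offDiag, mul_sub, sub_mul, Matrix.sub_apply, hU.conj_diagonal_apply _ hxy]
    by_cases e : x = y
    · subst e
      have hx : x.1 ∉ S := fun hx => hxy ⟨hx, hx⟩
      rw [Matrix.diagonal_apply_eq, Matrix.diagonal_apply_eq, Matrix.diag_apply,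
        Matrix.diag_apply, hU.mul_apply _ _ hx, hU.transpose_mul_apply _ _ hx]
    · rw [Matrix.diagonal_apply_ne _ e, Matrix.diagonal_apply_ne _ e]

/-- Part of a sweep: steps `k₀, …, k₀ + i - 1`, where `k₀ = c * O.length` starts a sweep. -/
lemma IsBlockJacobi.run_take {O : PivotSeq m} {N : ℕ} {A U : ℕ → BlockMatrix ν}
    (h : IsBlockJacobi O N A U)
    (hdet : ∀ k < N, ∀ a, pivot O k = some a → ∀ r ∈ pivotSet a, δ ≤ |(block (U k) r r).det|)
    (c i : ℕ) (hi : i ≤ O.length) (hN : c * O.length + i ≤ N) :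
    Run δ ((O.take i).map pivotSet) (offDiag (A (c * O.length)))
      (offDiag (A (c * O.length + i))) := by
  induction i with
  | zero => exact .nil _
  | succ i ih =>
    have hi' : i < O.length := hi
    have hk : c * O.length + i < N := hN
    have hpiv : pivot O (c * O.length + i) = some O[i] := by
      rw [pivot, Nat.mul_add_mod_self_right, Nat.mod_eq_of_lt hi', List.getElem?_eq_getElem hi']
    obtain ⟨a, ha, hel, hA, h0⟩ := h _ hk
    obtain rfl : O[i] = a := Option.some.inj (hpiv.symm.trans ha)
    have hU : U (c * O.length + i) ∈ rotations ν δ (pivotSet O[i]) := by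
      refine ⟨hel.1, fun x y hxy => hel.2 x y ?_, hdet _ hk _ hpiv⟩
      rwa [mem_pivotSet, mem_pivotSet] at hxy
    rw [List.take_succ_eq_append_getElem hi', List.map_append]
    refine (ih hi'.le hk.le).append (.cons hU ?_)
    rw [← offDiag_conj hU.2.1, ← hA]
    · exact .nil _
    · intro x y hx hy hxy
      rw [← hA]
      exact h0 x y (mem_pivotSet.1 hx) (mem_pivotSet.1 hy) hxy

lemma IsBlockJacobi.run {O : PivotSeq m} {N : ℕ} {A U : ℕ → BlockMatrix ν}
    (h : IsBlockJacobi O N A U)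
    (hdet : ∀ k < N, ∀ a, pivot O k = some a → ∀ r ∈ pivotSet a, δ ≤ |(block (U k) r r).det|)
    (c : ℕ) (hN : c * O.length ≤ N) :
    Run δ (List.replicate c (O.map pivotSet)).flatten (offDiag (A 0))
      (offDiag (A (c * O.length))) := by
  induction c with
  | zero =>
    rw [Nat.zero_mul]
    exact .nil _
  | succ c ih =>
    rw [Nat.succ_mul] at hN ⊢
    rw [List.replicate_succ', List.flatten_append, List.flatten_singleton]
    refine (ih (by omega)).append ?_
    have := h.run_take hdet c O.length le_rfl hN
    rwa [List.take_length] at this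

/-! ### The determinants of the diagonal blocks -/

/-- The absolute value of the determinant is the product of the singular values. -/
lemma pow_le_abs_det {k : ℕ} {X : Matrix (Fin k) (Fin k) ℝ} {c : ℝ} (hc : 0 ≤ c)
    (h : c ≤ sigmaMin X) : c ^ k ≤ |X.det| := by
  have hdet : LinearMap.det (Matrix.toEuclideanLin X) = X.det := by
    rw [Matrix.toEuclideanLin, Matrix.toLpLin_eq_toLin, LinearMap.det_toLin]
  rw [← hdet, ← LinearMap.normDet_eq_abs_det, LinearMap.normDet_eq_prod_singularValues,
    finrank_euclideanSpace_fin]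
  calc c ^ k = ∏ _i ∈ Finset.range k, c := by simp
    _ ≤ _ := Finset.prod_le_prod (fun _ _ => hc) fun i hi =>
      h.trans (LinearMap.singularValues_antitone _ (Nat.le_sub_one_of_lt (Finset.mem_range.1 hi)))

/-- A lower bound, depending only on `n` and `ϱ`, for the determinants of the pivot diagonal
blocks of matrices in the classes `UBC`; the minimum with `1` makes it monotone in the order of
the block. -/
noncomputable def detBound (n : ℕ) (ϱ : ℝ) : ℝ :=
  min 1 (ϱ * (3 / √(((4 : ℝ) ^ n + 6 * n) * (n + 1)))) ^ n

lemma detBound_base_pos (n : ℕ) {ϱ : ℝ} (hϱ : 0 < ϱ) :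
    0 < min 1 (ϱ * (3 / √(((4 : ℝ) ^ n + 6 * n) * (n + 1)))) :=
  lt_min one_pos (by positivity)

lemma le_gammaBound {s t n : ℕ} (hs : s ≤ n) (ht : t ≤ n) (ht1 : 1 ≤ t) :
    3 / √(((4 : ℝ) ^ n + 6 * n) * (n + 1)) ≤ gammaBound s t := by
  have h1 : (1 : ℝ) ≤ 4 ^ s := one_le_pow₀ (by norm_num)
  have h2 : (4 : ℝ) ^ s ≤ 4 ^ n := pow_le_pow_right₀ (by norm_num) hs
  have h3 : (t : ℝ) ≤ n := by exact_mod_cast ht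
  have h4 : (1 : ℝ) ≤ t := by exact_mod_cast ht1
  refine div_le_div_of_nonneg_left (by norm_num) (Real.sqrt_pos.2 ?_) (Real.sqrt_le_sqrt ?_)
  · exact mul_pos (by linarith) (by linarith)
  · exact mul_le_mul (by linarith) (by linarith) (by linarith) (by linarith)

/-- Membership of the relabelled matrix in a class `UBC` bounds the determinants, whichever
relabelling is used. -/
lemma detBound_le_abs_det {ϱ : ℝ} (hϱ : 0 < ϱ) (hν : ∀ r, 1 ≤ ν r) (p : Equiv.Perm (Fin m))
    {U : BlockMatrix ν} {a : Fin m × Fin m}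
    (h : relabelMatrix p U ∈ UBC (permPartition p ν) ϱ (relabelPair p a)) {r : Fin m}
    (hr : r ∈ pivotSet a) : detBound (∑ r, ν r) ϱ ≤ |(block U r r).det| := by
  obtain ⟨-, heq, hle⟩ := h
  have hn : ∀ s, ν s ≤ ∑ r, ν r := fun s =>
    Finset.single_le_sum (f := ν) (fun _ _ => Nat.zero_le _) (Finset.mem_univ s)
  have hγ := le_gammaBound (hn (p.symm (relabelPair p a).1)) (hn (p.symm (relabelPair p a).2))
    (hν _)
  have hb := (mul_le_mul_of_nonneg_left hγ hϱ.le).trans hle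
  have hmem : p r ∈ pivotSet (relabelPair p a) := by
    rw [pivotSet_relabelPair]
    exact Finset.mem_image_of_mem _ hr
  have hσ : ϱ * (3 / √(((4 : ℝ) ^ (∑ r, ν r) + 6 * (∑ r, ν r : ℕ)) * ((∑ r, ν r : ℕ) + 1))) ≤
      sigmaMin (block U (p.symm (p r)) (p.symm (p r))) := by
    rcases mem_pivotSet.1 hmem with e | e <;> rw [e]
    · exact hb
    · exact hb.trans_eq heq
  rw [Equiv.symm_apply_apply] at hσ
  have h0 := detBound_base_pos (∑ r, ν r) hϱ
  exact (pow_le_pow_of_le_one h0.le (min_le_left _ _) (hn r)).trans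
    (pow_le_abs_det h0.le ((min_le_right _ _).trans hσ))

end BlockJacobi

theorem mainTheorem1 :
    ∃ (η : (m : ℕ) → (Fin m → ℕ) → ℝ → ℝ) (ηt : ℕ → ℝ → ℝ),
      ∀ (m : ℕ) (ν : Fin m → ℕ) (ϱ : ℝ), 2 ≤ m → (∀ r, 1 ≤ ν r) → 0 < ϱ → ϱ ≤ 1 →
        (0 ≤ η m ν ϱ ∧ η m ν ϱ < ηt (∑ r, ν r) ϱ ∧ ηt (∑ r, ν r) ϱ < 1) ∧
        ∀ (O O'' : PivotSeq m) (q : Equiv.Perm (Fin m)) (d : ℕ),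
          O ∈ generalizedSerialOrderings m →
          O'' ∈ serialPermOrderings m →
          CanonicalChain q d O O'' →
          ∀ (p : Equiv.Perm (Fin m)) (A U : ℕ → BlockMatrix ν),
            (A 0).IsSymm →
            IsBlockJacobi O ((d + 1) * O.length) A U →
            (∀ k < (d + 1) * O.length, ∀ a, pivot O k = some a →
              relabelMatrix p (U k) ∈ UBC (permPartition p ν) ϱ (relabelPair p a)) →
            offNorm (A ((d + 1) * O.length)) ^ 2 ≤
              η m (permPartition q ν) ϱ * offNorm (A 0) ^ 2 := by
  choose η h0 h1 hη using fun (n : ℕ) (ϱ : ℝ) => exists_contracts_of_sum_eq n (detBound n ϱ)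
  refine ⟨fun m ν ϱ => η (∑ r, ν r) ϱ, fun n ϱ => (η n ϱ + 1) / 2,
    fun m ν ϱ hm hν hϱ _ => ⟨⟨h0 _ _, ?_, ?_⟩, ?_⟩⟩
  · have := h1 (∑ r, ν r) ϱ
    dsimp only
    linarith
  · have := h1 (∑ r, ν r) ϱ
    dsimp only
    linarith
  · intro O O'' q d _ hO'' hchain p A U hA hJ hU
    -- The factor is asked for at `permPartition q ν`, which is a partition of the same `n`.
    have hsum : ∑ r, permPartition q ν r = ∑ r, ν r := Equiv.sum_comp q.symm ν
    have hδ : 0 < detBound (∑ r, ν r) ϱ := pow_pos (detBound_base_pos _ hϱ) _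
    have hrun := hJ.run (fun k hk a ha r hr => detBound_le_abs_det hϱ hν p (hU k hk a ha) hr)
      (d + 1) le_rfl
    have hcon := hchain.contracts (h0 _ _) hδ hm (hη (∑ r, ν r) ϱ m ν hν rfl) hO''
      _ _ (isSymm_offDiag hA) hrun
    rw [offNorm_sq, offNorm_sq]
    dsimp only
    rw [hsum]
    linarith
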